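/- All trees are finite. A set $D$ of vertices of a graph $G$ without isolated vertices is a dominating set if every vertex not in $D$ has a neighbour in $D$; it is a semitotal dominating set if, moreover, every vertex of $D$ is within distance $2$ of another vertex of $D$. Let $\gamma(G)$ and $\gamma_{t2}(G)$ be the minimum cardinality of a dominating set and of a semitotal dominating set of $G$, respectively. A labeling of a tree $T$ is a partition $S=(S_A,S_B,S_C,S_D,S_E)$ of $V(T)$ into five possibly empty classes; a vertex in $S_x$ has status $x$. Let $\mathscr{T}$ be the smallest family of labeled trees $(T,S)$, considered up to label-preserving isomorphism, that contains the path $P_6$ whose vertices have, in order along the path, the statuses $C,A,D,E,B,C$, and that is closed under the following two operations. - $\mathscr{O}_1$: choose a vertex $v$ of status $A$ or $B$, and add a new vertex $u$ of status $C$ and the edge $uv$. - $\mathscr{O}_2$: choose a vertex $v$ of status $A$, and add a new path $u_1u_2u_3u_4$ and the edge $u_1v$, where $u_1,u_2,u_3,u_4$ have the statuses $D,E,B,C$, respectively. **Theorem 3.1.** Let $T$ be a tree with at least two vertices. If $T$ is not a star $K_{1,m}$, then $\gamma_{t2}(T)\le 2\gamma(T)-1$. Moreover, $\gamma_{t2}(T)=2\gamma(T)-1$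 if and only if $(T,S)\in\mathscr{T}$ for some labeling $S$ of $T$. -/

import Mathlib

namespace SemitotalDomination

universe u

/-- `D` is a dominating set of `G`: every vertex outside `D` has a neighbour in `D`. -/
def IsDominating {V : Type u} (G : SimpleGraph V) (D : Finset V) : Prop :=
  ∀ v, v ∉ D → ∃ w ∈ D, G.Adj v w

/-- `D` is a semitotal dominating set of `G`: it is dominating, and every vertex of `D` is within
distance `2` of another vertex of `D`. (The extended distance `edist` is infinite between vertices
in different components.) -/
def IsSemitotalDominating {V : Type u} (G : SimpleGraph V) (D : Finset V) : Prop :=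
  IsDominating G D ∧ ∀ v ∈ D, ∃ w ∈ D, w ≠ v ∧ G.edist v w ≤ 2

/-- The domination number: the minimum cardinality of a dominating set. -/
noncomputable def dominationNumber {V : Type u} (G : SimpleGraph V) : ℕ :=
  sInf {n | ∃ D : Finset V, IsDominating G D ∧ D.card = n}

/-- The semitotal domination number: the minimum cardinality of a semitotal dominating set.
Such a set exists in every finite graph without isolated vertices. -/
noncomputable def semitotalDominationNumber {V : Type u} (G : SimpleGraph V) : ℕ :=
  sInf {n | ∃ D : Finset V, IsSemitotalDominating G D ∧ D.card = n}

/-- In a finite graph without isolated vertices the set of all vertices is semitotal dominating, so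
the minimum defining the semitotal domination number is over a nonempty set. -/
theorem exists_isSemitotalDominating {V : Type u} [Fintype V] (G : SimpleGraph V)
    (h : ∀ v, ∃ w, G.Adj v w) : ∃ D : Finset V, IsSemitotalDominating G D := by
  refine ⟨Finset.univ, fun v hv => absurd (Finset.mem_univ v) hv, fun v _ => ?_⟩
  obtain ⟨w, hw⟩ := h v
  refine ⟨w, Finset.mem_univ w, hw.ne', ?_⟩
  rw [SimpleGraph.edist_eq_one_iff_adj.mpr hw]
  norm_num

/-- `G` is a star `K_{1,m}` (`m ≥ 0`): some vertex `r` is such that the edges of `G` are exactly the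
pairs formed by `r` and another vertex. -/
def IsStar {V : Type u} (G : SimpleGraph V) : Prop :=
  ∃ r : V, G = SimpleGraph.starGraph r

/-- The five statuses. A labeling of the vertex set `V`, that is, a partition of `V` into (possibly
empty) classes `S_A, S_B, S_C, S_D, S_E`, is a function `S : V → Status`. -/
inductive Status : Type
  | A | B | C | D | E

/-- The graph obtained from `G` by adding a path `u_0 u_1 ⋯ u_k` on `k + 1` new vertices and the
edge `v u_0`. -/
def attachPath {V : Type u} (G : SimpleGraph V) (v : V) (k : ℕ) :
    SimpleGraph (V ⊕ Fin (k + 1)) :=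
  (G ⊕g SimpleGraph.pathGraph (k + 1)) ⊔ SimpleGraph.edge (Sum.inl v) (Sum.inr 0)

/-- The family of labeled trees, up to isomorphism of labeled graphs, that contains the path `P_6`
labeled `C, A, D, E, B, C` along the path and is closed under the two operations:
* `opOne`: attach one new vertex of status `C` to a vertex of status `A` or `B`;
* `opTwo`: attach to a vertex of status `A`, by its first vertex, a new path on four vertices with
  statuses `D, E, B, C`. -/
inductive Family : ∀ {V : Type u}, SimpleGraph V → (V → Status) → Prop
  | base {V : Type u} {G : SimpleGraph V} {S : V → Status}
      (e : SimpleGraph.pathGraph 6 ≃g G)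
      (hS : ∀ i, S (e i) =
        (![Status.C, Status.A, Status.D, Status.E, Status.B, Status.C] : Fin 6 → Status) i) :
      Family G S
  | opOne {V : Type u} {G : SimpleGraph V} {S : V → Status} (h : Family G S)
      (v : V) (hv : S v = Status.A ∨ S v = Status.B) :
      Family (attachPath G v 0) (Sum.elim S ![Status.C])
  | opTwo {V : Type u} {G : SimpleGraph V} {S : V → Status} (h : Family G S)
      (v : V) (hv : S v = Status.A) :
      Family (attachPath G v 3) (Sum.elim S ![Status.D, Status.E, Status.B, Status.C])
  | iso {V W : Type u} {G : SimpleGraph V} {H : SimpleGraph W} {S : V → Status} {S' : W → Status}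
      (h : Family G S) (e : G ≃g H) (hS : ∀ v, S' (e v) = S v) :
      Family H S'

end SemitotalDomination

namespace SemitotalDomination

universe u

variable {V : Type u} {G : SimpleGraph V}

/-! Upper bound. A dominating set `D` becomes semitotal after adding one neighbour for each member
that has no partner, at cost at most `2 * D.card`. Each added vertex that serves several members
saves cost (`semitotalDominationNumber_add_card_le`). In a connected graph with `2 ≤ D.card`, some
edge joins the fibres of two members under a choice of dominators, and this saves one
(`semitotalDominationNumber_lt_two_mul`).

Equality forces structure. If nothing more can be saved, two edges between fibres cannot involve
four different members, and acyclicity excludes triangles of fibres. So the fibres form a star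
around a centre `a`, and each other member `b` hangs on it through a path `a, d b, e b, b`. All
remaining vertices are leaves. Both `a` and each `b` carry a leaf, since otherwise an exchange would
save too much. This gives the local description `IsLegged` (`IsExtremal.exists_isLegged`). Pruning
spare leaves and whole legs down to `P₆` then puts the tree in the family (`IsLegged.family`).

Conversely, both operations preserve `IsLegged`. In such a graph every semitotal dominating set has
at least two vertices in each leg and one at the centre or its leaves
(`IsLegged.exists_isDominating`). -/

theorem edist_le_two_of_adj {v w : V} (h : G.Adj v w) : G.edist v w ≤ 2 := by
  rw [SimpleGraph.edist_eq_one_iff_adj.mpr h]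
  norm_num

theorem edist_le_two_of_adj_of_adj {u v w : V} (h₁ : G.Adj v u) (h₂ : G.Adj u w) :
    G.edist v w ≤ 2 := by
  simpa using G.edist_le (.cons h₁ (.cons h₂ .nil))

theorem adj_or_exists_adj_of_edist_le_two {v w : V} (h : G.edist v w ≤ 2) (hne : w ≠ v) :
    G.Adj v w ∨ ∃ u, G.Adj v u ∧ G.Adj u w := by
  obtain ⟨p, hp⟩ := SimpleGraph.exists_walk_of_edist_ne_top
    (ne_top_of_le_ne_top (by norm_num) h : G.edist v w ≠ ⊤)
  rw [← hp] at h
  have hl : p.length ≤ 2 := by exact_mod_cast h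
  cases p with
  | nil => exact absurd rfl hne
  | cons h₁ p => cases p with
    | nil => exact .inl h₁
    | cons h₂ p => cases p with
      | nil => exact .inr ⟨_, h₁, h₂⟩
      | cons h₃ p => simp at hl

/-! ### Enlarging dominating sets to semitotal ones -/

theorem semitotalDominationNumber_le {D : Finset V} (hD : IsSemitotalDominating G D) :
    semitotalDominationNumber G ≤ D.card :=
  Nat.sInf_le ⟨D, hD, rfl⟩

theorem dominationNumber_le {D : Finset V} (hD : IsDominating G D) :
    dominationNumber G ≤ D.card :=
  Nat.sInf_le ⟨D, hD, rfl⟩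

theorem exists_card_eq_dominationNumber [Fintype V] (G : SimpleGraph V) :
    ∃ D : Finset V, IsDominating G D ∧ D.card = dominationNumber G :=
  Nat.sInf_mem (s := {n | ∃ D : Finset V, IsDominating G D ∧ D.card = n})
    ⟨_, Finset.univ, fun v hv => absurd (Finset.mem_univ v) hv, rfl⟩

theorem exists_card_eq_semitotalDominationNumber [Fintype V] (h : ∀ v, ∃ w, G.Adj v w) :
    ∃ D : Finset V, IsSemitotalDominating G D ∧ D.card = semitotalDominationNumber G := by
  obtain ⟨D, hD⟩ := exists_isSemitotalDominating G h
  exact Nat.sInf_mem (s := {n | ∃ D : Finset V, IsSemitotalDominating G D ∧ D.card = n})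
    ⟨_, D, hD, rfl⟩

/-- A dominating set `D` extends to a semitotal dominating set by adding a set `X` of neighbours of
`D` and one neighbour of each vertex of `D` that has no partner in `D ∪ X` yet. -/
theorem semitotalDominationNumber_add_card_le (hG : ∀ v, ∃ w, G.Adj v w) {D X K : Finset V}
    (hD : IsDominating G D) (hX : ∀ x ∈ X, ∃ d ∈ D, G.Adj x d) (hKD : K ⊆ D)
    (hK : ∀ d ∈ K, ∃ w, (w ∈ D ∨ w ∈ X) ∧ w ≠ d ∧ G.edist d w ≤ 2) :
    semitotalDominationNumber G + K.card ≤ 2 * D.card + X.card := by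
  classical
  choose nb hnb using hG
  have hsemi : IsSemitotalDominating G (D ∪ (X ∪ (D \ K).image nb)) := by
    refine ⟨fun v hv => ?_, fun v hv => ?_⟩
    · obtain ⟨w, hw, hvw⟩ := hD v fun h => hv (Finset.mem_union_left _ h)
      exact ⟨w, Finset.mem_union_left _ hw, hvw⟩
    · have near : (∃ d ∈ D, G.Adj v d) → ∃ w ∈ D ∪ (X ∪ (D \ K).image nb), w ≠ v ∧
          G.edist v w ≤ 2 := fun ⟨d, hd, hvd⟩ =>
        ⟨d, Finset.mem_union_left _ hd, hvd.ne', edist_le_two_of_adj hvd⟩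
      rcases Finset.mem_union.1 hv with hvD | hv
      · by_cases hvK : v ∈ K
        · obtain ⟨w, hw, h⟩ := hK v hvK
          refine ⟨w, ?_, h⟩
          rcases hw with hw | hw <;> simp [hw]
        · refine ⟨nb v, ?_, (hnb v).ne', edist_le_two_of_adj (hnb v)⟩
          exact Finset.mem_union_right _ (Finset.mem_union_right _
            (Finset.mem_image_of_mem nb (Finset.mem_sdiff.2 ⟨hvD, hvK⟩)))
      · rcases Finset.mem_union.1 hv with hvX | hv
        · exact near (hX v hvX)
        · obtain ⟨d, hd, rfl⟩ := Finset.mem_image.1 hv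
          exact near ⟨d, (Finset.mem_sdiff.1 hd).1, (hnb d).symm⟩
  have h₁ := semitotalDominationNumber_le hsemi
  have h₂ := Finset.card_union_le D (X ∪ (D \ K).image nb)
  have h₃ := Finset.card_union_le X ((D \ K).image nb)
  have h₄ := Finset.card_image_le (s := D \ K) (f := nb)
  have h₅ := Finset.card_sdiff_add_card_eq_card hKD
  omega

theorem semitotalDominationNumber_le_two_mul (hG : ∀ v, ∃ w, G.Adj v w) {D : Finset V}
    (hD : IsDominating G D) : semitotalDominationNumber G ≤ 2 * D.card := by
  simpa using semitotalDominationNumber_add_card_le hG hD (X := ∅) (K := ∅) (by simp) (by simp)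
    (by simp)

/-- `p` and `q` are partners of each other, so neither needs an added neighbour. -/
theorem semitotalDominationNumber_add_two_le_of_near (hG : ∀ v, ∃ w, G.Adj v w) {D : Finset V}
    (hD : IsDominating G D) {p q : V} (hp : p ∈ D) (hq : q ∈ D) (hpq : p ≠ q)
    (h : G.edist p q ≤ 2) : semitotalDominationNumber G + 2 ≤ 2 * D.card := by
  classical
  have := semitotalDominationNumber_add_card_le hG hD (X := ∅) (K := {p, q}) (by simp)
    (by simp [Finset.insert_subset_iff, hp, hq]) (by
      simp only [Finset.mem_insert, Finset.mem_singleton, Finset.notMem_empty, or_false]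
      rintro d (rfl | rfl)
      · exact ⟨q, hq, hpq.symm, h⟩
      · exact ⟨p, hp, hpq, by rwa [SimpleGraph.edist_comm]⟩)
  simpa [Finset.card_pair hpq] using this

theorem two_le_semitotalDominationNumber [Fintype V] [Nonempty V] (hG : ∀ v, ∃ w, G.Adj v w) :
    2 ≤ semitotalDominationNumber G := by
  obtain ⟨D, hD, hc⟩ := exists_card_eq_semitotalDominationNumber hG
  rw [← hc]
  have : ∃ v, v ∈ D := by
    obtain ⟨v⟩ := ‹Nonempty V›
    by_cases hv : v ∈ D
    · exact ⟨v, hv⟩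
    · obtain ⟨w, hw, -⟩ := hD.1 v hv
      exact ⟨w, hw⟩
  obtain ⟨v, hv⟩ := this
  obtain ⟨w, hw, hne, -⟩ := hD.2 v hv
  exact Finset.one_lt_card.2 ⟨v, hv, w, hw, hne.symm⟩

/-! ### Fibres of a dominating set, cuts, and the upper bound -/

/-- `f` sends every vertex to a member of `D` that dominates it, and fixes `D`. -/
structure IsDominator (G : SimpleGraph V) (D : Finset V) (f : V → V) : Prop where
  mem : ∀ v, f v ∈ D
  eq_self : ∀ v ∈ D, f v = v
  adj : ∀ v, v ∉ D → G.Adj v (f v)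

theorem IsDominating.exists_isDominator {D : Finset V} (hD : IsDominating G D) :
    ∃ f, IsDominator G D f := by
  have : ∀ v, ∃ w, w ∈ D ∧ (v ∈ D → w = v) ∧ (v ∉ D → G.Adj v w) := by
    intro v
    by_cases hv : v ∈ D
    · exact ⟨v, hv, fun _ => rfl, fun h => absurd hv h⟩
    · obtain ⟨w, hw, h⟩ := hD v hv
      exact ⟨w, hw, fun h => absurd h hv, fun _ => h⟩
  choose f h₁ h₂ h₃ using this
  exact ⟨f, h₁, h₂, h₃⟩

theorem exists_adj_mem_notMem (hG : G.Connected) (Q : Set V) {a b : V} (ha : a ∈ Q)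
    (hb : b ∉ Q) : ∃ x y, G.Adj x y ∧ x ∈ Q ∧ y ∉ Q := by
  obtain ⟨p⟩ := hG.preconnected a b
  obtain ⟨d, -, h₁, h₂⟩ := p.exists_boundary_dart Q ha hb
  exact ⟨d.fst, d.snd, d.adj, h₁, h₂⟩

/-- Every edge `xy` of an acyclic graph defines a cut that contains no other edge. -/
theorem exists_cut_of_isAcyclic (hG : G.IsAcyclic) {x y : V} (h : G.Adj x y) :
    ∃ W : Set V, x ∈ W ∧ y ∉ W ∧ ∀ u v, G.Adj u v → u ∈ W → v ∉ W → u = x ∧ v = y := by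
  have hb := SimpleGraph.isBridge_iff.1 (SimpleGraph.isAcyclic_iff_forall_adj_isBridge.1 hG h)
  refine ⟨{v | (G.deleteEdges {s(x, y)}).Reachable x v}, .refl _, hb, fun u v huv hu hv => ?_⟩
  by_contra hne
  by_cases he : s(u, v) = s(x, y)
  · rcases Sym2.eq_iff.1 he with h | ⟨rfl, rfl⟩
    · exact hne h
    · exact hb hu
  · exact hv (hu.trans (SimpleGraph.Adj.reachable
      (SimpleGraph.deleteEdges_adj.2 ⟨huv, he⟩)))

/-- The cut at the edge `x y` splits no fibre: an edge from `v` to `f v` crossing it would be `x y`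
itself, which would force `f x = f y`. Hence `x y` is the only edge between the two unions of
fibres. -/
theorem IsDominator.exists_cut {D : Finset V} {f : V → V} (hf : IsDominator G D f)
    (hG : G.IsAcyclic) {x y : V} (h : G.Adj x y) (hne : f x ≠ f y) :
    ∃ Q : Set V, f x ∈ Q ∧ f y ∉ Q ∧
      ∀ u v, G.Adj u v → f u ∈ Q → f v ∉ Q → u = x ∧ v = y := by
  obtain ⟨W, hx, hy, hW⟩ := exists_cut_of_isAcyclic hG h
  have key : ∀ v, f v ∈ W ↔ v ∈ W := by
    intro v
    by_cases hv : v ∈ D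
    · rw [hf.eq_self v hv]
    · have hff := hf.eq_self _ (hf.mem v)
      constructor <;> intro h₁ <;> by_contra h₂
      · obtain ⟨h₃, rfl⟩ := hW _ _ (hf.adj v hv).symm h₁ h₂
        rw [h₃] at hff
        exact hne (hff.trans h₃.symm)
      · obtain ⟨rfl, h₃⟩ := hW _ _ (hf.adj v hv) h₁ h₂
        rw [h₃] at hff
        exact hne (h₃.trans hff.symm)
  refine ⟨W, (key x).2 hx, fun h => hy ((key y).1 h), fun u v huv hu hv => ?_⟩
  exact hW u v huv ((key u).1 hu) fun h => hv ((key v).2 h)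

theorem IsDominator.edist_le_two {D : Finset V} {f : V → V} (hf : IsDominator G D f) {x y : V}
    (h : G.Adj x y) : G.edist (f x) y ≤ 2 := by
  by_cases hx : x ∈ D
  · rw [hf.eq_self x hx]
    exact edist_le_two_of_adj h
  · exact edist_le_two_of_adj_of_adj (hf.adj x hx).symm h

/-- By connectedness some edge `x y` leaves the fibre of `p`. If `y ∈ D`, then `p` and `y` are
partners and two vertices are saved. Otherwise the single added vertex `y` serves both `p` and `f
y`. -/
theorem semitotalDominationNumber_lt_two_mul (hG : G.Connected) (hG' : ∀ v, ∃ w, G.Adj v w)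
    {D : Finset V} (hD : IsDominating G D) (hc : 2 ≤ D.card) :
    semitotalDominationNumber G + 1 ≤ 2 * D.card := by
  classical
  obtain ⟨f, hf⟩ := hD.exists_isDominator
  obtain ⟨p, hp, q, hq, hpq⟩ := Finset.one_lt_card.1 hc
  obtain ⟨x, y, hxy, hx, hy⟩ := exists_adj_mem_notMem hG {v | f v = p} (hf.eq_self p hp)
    (b := q)
    (by simpa [hf.eq_self q hq] using hpq.symm)
  simp only [Set.mem_ofPred_eq] at hx hy
  by_cases hyD : y ∈ D
  · rw [hf.eq_self y hyD] at hy
    have := semitotalDominationNumber_add_two_le_of_near hG' hD hp hyD (Ne.symm hy)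
      (hx ▸ hf.edist_le_two hxy)
    omega
  · have hpy : y ≠ p := fun h => hyD (h ▸ hp)
    have := semitotalDominationNumber_add_card_le hG' hD (X := {y}) (K := {p, f y})
      (by simpa using ⟨f y, hf.mem y, hf.adj y hyD⟩)
      (by simp [Finset.insert_subset_iff, hp, hf.mem]) (by
        simp only [Finset.mem_insert, Finset.mem_singleton]
        rintro d (rfl | rfl)
        · exact ⟨y, .inr rfl, hpy, hx ▸ hf.edist_le_two hxy⟩
        · exact ⟨y, .inr rfl, (hf.adj y hyD).ne, edist_le_two_of_adj (hf.adj y hyD).symm⟩)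
    rw [Finset.card_pair (Ne.symm hy)] at this
    simp at this
    omega

theorem isStar_of_isDominating_card_le_one (hG : G.IsTree) {D : Finset V}
    (hD : IsDominating G D) (hc : D.card ≤ 1) : IsStar G := by
  have hne : D.Nonempty := by
    obtain ⟨v⟩ := hG.1.nonempty
    by_cases hv : v ∈ D
    · exact ⟨v, hv⟩
    · obtain ⟨w, hw, -⟩ := hD v hv
      exact ⟨w, hw⟩
  obtain ⟨r, rfl⟩ := Finset.card_eq_one.1 (le_antisymm hc hne.card_pos)
  have hr : ∀ v, v ≠ r → G.Adj v r := fun v hv => by simpa using hD v (by simpa using hv)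
  refine ⟨r, ?_⟩
  ext x y
  rw [SimpleGraph.starGraph_adj]
  refine ⟨fun h => ⟨h.ne, ?_⟩, ?_⟩
  · by_contra! hxy
    -- An edge avoiding `r` would close a triangle with `r`: whichever side of the cut contains `r`,
    -- a second edge crosses it.
    obtain ⟨W, hx, hy, hW⟩ := exists_cut_of_isAcyclic hG.2 h
    by_cases hrW : r ∈ W
    · exact hxy.1 (hW r y (hr y hxy.2).symm hrW hy).1.symm
    · exact hxy.2 (hW x r (hr x hxy.1) hx hrW).2.symm
  · rintro ⟨h, rfl | rfl⟩
    · exact (hr y h.symm).symm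
    · exact hr x h

/-! ### Attaching pendant paths -/

section AttachPath

variable {v : V} {k : ℕ}

@[simp]
theorem attachPath_adj_inl_inl {x y : V} :
    (attachPath G v k).Adj (.inl x) (.inl y) ↔ G.Adj x y := by
  simp [attachPath, SimpleGraph.edge_adj]

@[simp]
theorem attachPath_adj_inr_inr {i j : Fin (k + 1)} :
    (attachPath G v k).Adj (.inr i) (.inr j) ↔ (SimpleGraph.pathGraph (k + 1)).Adj i j := by
  simp [attachPath, SimpleGraph.edge_adj]

@[simp]
theorem attachPath_adj_inl_inr {x : V} {i : Fin (k + 1)} :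
    (attachPath G v k).Adj (.inl x) (.inr i) ↔ x = v ∧ i = 0 := by
  simp [attachPath, SimpleGraph.edge_adj]

@[simp]
theorem attachPath_adj_inr_inl {x : V} {i : Fin (k + 1)} :
    (attachPath G v k).Adj (.inr i) (.inl x) ↔ x = v ∧ i = 0 := by
  rw [SimpleGraph.adj_comm, attachPath_adj_inl_inr]

/-- A graph with a pendant path arises by attaching that path to the rest of the graph. -/
theorem exists_iso_attachPath (p : Fin (k + 1) → V) (hp : p.Injective)
    (hpp : ∀ i j, G.Adj (p i) (p j) ↔ (SimpleGraph.pathGraph (k + 1)).Adj i j)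
    (hv : v ∉ Set.range p) (hvp : ∀ y ∉ Set.range p, ∀ i, G.Adj y (p i) ↔ y = v ∧ i = 0) :
    ∃ e : attachPath (G.induce (Set.range p)ᶜ) ⟨v, hv⟩ k ≃g G,
      (∀ y, e (.inl y) = y) ∧ ∀ i, e (.inr i) = p i := by
  have hbij : Function.Bijective
      (Sum.elim Subtype.val p : ((Set.range p)ᶜ : Set V) ⊕ Fin (k + 1) → V) := by
    constructor
    · refine Subtype.val_injective.sumElim hp fun y i h => y.2 ⟨i, h.symm⟩
    · intro y
      by_cases hy : y ∈ Set.range p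
      · obtain ⟨i, rfl⟩ := hy
        exact ⟨.inr i, rfl⟩
      · exact ⟨.inl ⟨y, hy⟩, rfl⟩
  refine ⟨⟨Equiv.ofBijective _ hbij, ?_⟩, fun y => rfl, fun i => rfl⟩
  rintro (x | i) (y | j)
  · simp
  · simpa [Subtype.ext_iff] using hvp x x.2 j
  · simpa [Subtype.ext_iff, G.adj_comm] using hvp y y.2 i
  · simpa using hpp i j

end AttachPath

/-! ### The family and its local description -/

/-- A local description of the labeled trees of the family: `a` is the only vertex of status `A`,
it carries leaves and legs `D, E, B`, and every vertex of status `B` carries leaves. -/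
structure IsLegged (G : SimpleGraph V) (S : V → Status) (a : V) : Prop where
  eq_center : ∀ v, S v = .A ↔ v = a
  exists_B : ∃ b, S b = .B
  center_leaf : ∃ c, S c = .C ∧ G.Adj a c
  center_adj : ∀ y, G.Adj a y → S y = .C ∨ S y = .D
  leaf_B : ∀ b, S b = .B → ∃ c, S c = .C ∧ G.Adj b c
  adj_B : ∀ b, S b = .B → ∃ e, S e = .E ∧ G.Adj b e ∧ ∀ y, G.Adj b y → y = e ∨ S y = .C
  adj_C : ∀ c, S c = .C → ∃ w, (S w = .A ∨ S w = .B) ∧ ∀ y, G.Adj c y ↔ y = w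
  adj_D : ∀ d, S d = .D → ∃ e, S e = .E ∧ ∀ y, G.Adj d y ↔ y = e ∨ y = a
  adj_E : ∀ e, S e = .E → ∃ b d, S b = .B ∧ S d = .D ∧ ∀ y, G.Adj e y ↔ y = b ∨ y = d

theorem IsLegged.iso {W : Type*} {H : SimpleGraph W} {S : V → Status} {S' : W → Status}
    {a : V} (h : IsLegged G S a) (e : G ≃g H) (hS : ∀ v, S' (e v) = S v) :
    IsLegged H S' (e a) := by
  have hadj : ∀ x y, H.Adj (e x) (e y) ↔ G.Adj x y := fun x y => e.map_adj_iff
  have hinj : ∀ x y, e x = e y ↔ x = y := fun x y => e.injective.eq_iff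
  constructor <;> simp only [e.surjective.forall, e.surjective.exists, hadj, hinj, hS]
  exacts [h.1, h.2, h.3, h.4, h.5, h.6, h.7, h.8, h.9]

theorem isLegged_pathGraph_six : IsLegged (SimpleGraph.pathGraph 6)
    (![.C, .A, .D, .E, .B, .C] : Fin 6 → Status) 1 := by
  constructor <;> simp [Fin.forall_fin_succ, Fin.exists_fin_succ, SimpleGraph.pathGraph_adj]

theorem IsLegged.attachPath_zero {S : V → Status} {a v : V} (h : IsLegged G S a)
    (hv : S v = .A ∨ S v = .B) :
    IsLegged (attachPath G v 0) (Sum.elim S ![Status.C]) (.inl a) := by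
  -- Vertices of status `C`, `D`, `E` have fully prescribed neighbourhoods; none of them is `v`, so
  -- these are undisturbed.
  have hne : ∀ x, S x ≠ .A → S x ≠ .B → x ≠ v := by
    rintro x h₁ h₂ rfl
    exact hv.elim h₁ h₂
  constructor <;> simp [Sum.forall, Sum.exists, Fin.forall_fin_succ, Fin.exists_fin_succ,
    SimpleGraph.pathGraph_adj]
  · exact h.eq_center
  · exact h.exists_B
  · exact .inl h.center_leaf
  · exact h.center_adj
  · exact fun b hb => .inl (h.leaf_B b hb)
  · exact h.adj_B
  · refine ⟨fun c hc => ?_, hv⟩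
    obtain ⟨w, hw, hcw⟩ := h.adj_C c hc
    exact ⟨w, hw, hcw, hne c (by simp [hc]) (by simp [hc])⟩
  · intro d hd
    obtain ⟨e, he, hde⟩ := h.adj_D d hd
    exact ⟨e, he, hde, hne d (by simp [hd]) (by simp [hd])⟩
  · intro e he
    obtain ⟨b, d, hb, hd, hbd⟩ := h.adj_E e he
    exact ⟨b, hb, d, hd, hbd, hne e (by simp [he]) (by simp [he])⟩

theorem IsLegged.attachPath_three {S : V → Status} {a v : V} (h : IsLegged G S a)
    (hv : S v = .A) :
    IsLegged (attachPath G v 3) (Sum.elim S ![.D, .E, .B, .C]) (.inl a) := by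
  obtain rfl := (h.eq_center v).1 hv
  have hne : ∀ x, S x ≠ .A → x ≠ v := fun x h₁ h₂ => h₁ (h₂ ▸ hv)
  constructor <;> simp [Sum.forall, Sum.exists, Fin.forall_fin_succ, Fin.exists_fin_succ,
    SimpleGraph.pathGraph_adj]
  · exact h.eq_center
  · exact h.center_leaf
  · exact h.center_adj
  · exact h.leaf_B
  · intro b hb
    obtain ⟨e, he, hbe, hbC⟩ := h.adj_B b hb
    exact ⟨e, he, hbe, hbC, hne b (by simp [hb])⟩
  · intro c hc
    obtain ⟨w, hw, hcw⟩ := h.adj_C c hc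
    exact ⟨w, hw, hcw, hne c (by simp [hc])⟩
  · intro d hd
    obtain ⟨e, he, hde⟩ := h.adj_D d hd
    exact ⟨e, he, hde, hne d (by simp [hd])⟩
  · intro e he
    obtain ⟨b, d, hb, hd, hbd⟩ := h.adj_E e he
    exact ⟨b, hb, .inl ⟨d, hd, hbd, hne e (by simp [he])⟩⟩

theorem Family.exists_isLegged {S : V → Status} (h : Family G S) : ∃ a, IsLegged G S a := by
  induction h with
  | base e hS => exact ⟨_, isLegged_pathGraph_six.iso e hS⟩
  | opOne _ v hv ih => exact ih.imp' _ fun a ha => ha.attachPath_zero hv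
  | opTwo _ v hv ih => exact ih.imp' _ fun a ha => ha.attachPath_three hv
  | iso _ e hS ih => exact ih.imp' _ fun a ha => ha.iso e hS

/-- Tool for pruning. By `hs` the part `s` keeps every non-leaf neighbour of its non-central
vertices, so the witnesses in the local conditions survive. The centre is exempt, so that legs can
be cut off; the required leaves are supplied separately. -/
theorem IsLegged.induce {S : V → Status} {a : V} (h : IsLegged G S a) {s : Set V} (ha : a ∈ s)
    (hB : ∃ b ∈ s, S b = .B) (hleaf : ∃ c ∈ s, S c = .C ∧ G.Adj a c)
    (hleafB : ∀ b ∈ s, S b = .B → ∃ c ∈ s, S c = .C ∧ G.Adj b c)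
    (hs : ∀ x ∈ s, x ≠ a → ∀ y, G.Adj x y → S y ≠ .C → y ∈ s) :
    IsLegged (G.induce s) (fun x => S x) ⟨a, ha⟩ := by
  have hA := (h.eq_center a).2 rfl
  have hne : ∀ x, S x ≠ .A → x ≠ a := fun x h₁ h₂ => h₁ (h₂ ▸ hA)
  constructor <;> simp only [Subtype.forall, Subtype.exists, Subtype.mk.injEq,
    SimpleGraph.induce_adj]
  · exact fun v _ => h.eq_center v
  · obtain ⟨b, hb, h₁⟩ := hB
    exact ⟨b, hb, h₁⟩
  · obtain ⟨c, hc, h₁⟩ := hleaf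
    exact ⟨c, hc, h₁⟩
  · exact fun y _ => h.center_adj y
  · intro b hbs hb
    obtain ⟨c, hc, h₁⟩ := hleafB b hbs hb
    exact ⟨c, hc, h₁⟩
  · intro b hbs hb
    obtain ⟨e, he, hbe, hbC⟩ := h.adj_B b hb
    exact ⟨e, hs b hbs (hne b (by simp [hb])) e hbe (by simp [he]), he, hbe, fun y _ => hbC y⟩
  · intro c hcs hc
    obtain ⟨w, hw, hcw⟩ := h.adj_C c hc
    refine ⟨w, hs c hcs (hne c (by simp [hc])) w ((hcw w).2 rfl) ?_, hw, fun y _ => hcw y⟩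
    rcases hw with hw | hw <;> simp [hw]
  · intro d hds hd
    obtain ⟨e, he, hde⟩ := h.adj_D d hd
    exact ⟨e, hs d hds (hne d (by simp [hd])) e ((hde e).2 (.inl rfl)) (by simp [he]), he,
      fun y _ => hde y⟩
  · intro e hes he
    obtain ⟨b, d, hb, hd, hbd⟩ := h.adj_E e he
    have := hs e hes (hne e (by simp [he]))
    exact ⟨b, this b ((hbd b).2 (.inl rfl)) (by simp [hb]), d,
      this d ((hbd d).2 (.inr rfl)) (by simp [hd]), hb, hd, fun y _ => hbd y⟩

theorem IsLegged.eq_of_adj_leaf {S : V → Status} {a : V} (h : IsLegged G S a) {c x y : V}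
    (hc : S c = .C) (hx : G.Adj c x) (hy : G.Adj c y) : x = y := by
  obtain ⟨w, -, hw⟩ := h.adj_C c hc
  rw [(hw x).1 hx, (hw y).1 hy]

theorem Family.of_induce_compl_range {S : V → Status} {p : Fin 1 → V} {v : V}
    (hv : v ∉ Set.range p) (hvS : S v = .A ∨ S v = .B) (hpS : S (p 0) = .C)
    (hvp : ∀ y, G.Adj y (p 0) ↔ y = v)
    (h : Family (G.induce (Set.range p)ᶜ) (fun x => S x)) : Family G S := by
  obtain ⟨e, he, he'⟩ := exists_iso_attachPath (G := G) (k := 0) p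
    (Function.injective_of_subsingleton p) (by simp [Fin.forall_fin_succ, SimpleGraph.pathGraph_adj]) hv
    (by simpa [Fin.forall_fin_succ] using fun y _ => hvp y)
  refine (h.opOne ⟨v, hv⟩ hvS).iso e ?_
  simp [Sum.forall, Fin.forall_fin_succ, he, he', hpS]

/-- A labeled graph with the local description of the family belongs to the family: remove a
superfluous leaf or a whole leg until `P₆` is left. -/
theorem IsLegged.family [Finite V] {S : V → Status} {a : V} (h : IsLegged G S a) :
    Family G S := by
  induction hn : Nat.card V using Nat.strong_induction_on generalizing V with
  | _ n ih =>
  subst hn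
  have hA := (h.eq_center a).2 rfl
  have hcard : ∀ {k : ℕ} (p : Fin (k + 1) → V),
      Nat.card ((Set.range p)ᶜ : Set V) < Nat.card V := fun p =>
    Finite.card_subtype_lt (x := p 0) (by simp)
  -- Two leaves at one vertex: `x` can be removed, since `x'` remains as the required leaf.
  -- Otherwise supports have exactly one leaf each.
  by_cases h₁ : ∃ w x x', (S w = .A ∨ S w = .B) ∧ G.Adj w x ∧ G.Adj w x' ∧ S x = .C ∧
      S x' = .C ∧ x ≠ x'
  · obtain ⟨w, x, x', hw, hwx, hwx', hx, hx', hne⟩ := h₁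
    have hnex : ∀ y, S y ≠ .C → y ∈ (Set.range ![x])ᶜ := by
      rintro y hy
      simpa using fun h : y = x => hy (h ▸ hx)
    have hleaf : ∀ b c, S c = .C → G.Adj b c →
        ∃ c ∈ (Set.range ![x])ᶜ, S c = .C ∧ G.Adj b c := by
      intro b c hc hbc
      by_cases hcx : c = x
      · subst hcx
        rw [h.eq_of_adj_leaf hc hbc.symm hwx.symm]
        exact ⟨x', by simpa using hne.symm, hx', hwx'⟩
      · exact ⟨c, by simpa using hcx, hc, hbc⟩
    refine Family.of_induce_compl_range (p := ![x]) (v := w) ?_ hw hx (fun y => ?_)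
      (ih _ (hcard _) (h.induce (hnex a (by simp [hA])) ?_ ?_ ?_ ?_) rfl)
    · simpa using hwx.ne
    · exact ⟨fun hy => h.eq_of_adj_leaf hx hy.symm hwx.symm, fun hy => hy ▸ hwx⟩
    · obtain ⟨b, hb⟩ := h.exists_B
      exact ⟨b, hnex b (by simp [hb]), hb⟩
    · obtain ⟨c, hc, hac⟩ := h.center_leaf
      exact hleaf a c hc hac
    · intro b _ hb
      obtain ⟨c, hc, hbc⟩ := h.leaf_B b hb
      exact hleaf b c hc hbc
    · exact fun _ _ _ y _ hy => hnex y hy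
  replace h₁ : ∀ w x x', (S w = .A ∨ S w = .B) → G.Adj w x → G.Adj w x' → S x = .C →
      S x' = .C → x = x' := fun w x x' h₂ h₃ h₄ h₅ h₆ => by
    by_contra h₇
    exact h₁ ⟨w, x, x', h₂, h₃, h₄, h₅, h₆, h₇⟩
  obtain ⟨b, hb⟩ := h.exists_B
  obtain ⟨c, hc, hbc⟩ := h.leaf_B b hb
  obtain ⟨e, he, hbe, hbC⟩ := h.adj_B b hb
  obtain ⟨b', d, hb', hd, hed⟩ := h.adj_E e he
  obtain rfl : b = b' := ((hed b).1 hbe.symm).resolve_right fun h => by simp [← h, hb] at hd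
  obtain ⟨e', he', hde⟩ := h.adj_D d hd
  obtain rfl : e = e' := ((hde e).1 ((hed d).2 (.inr rfl)).symm).resolve_right
    fun h => by simp [h, hA] at he
  have hcadj : ∀ y, G.Adj c y ↔ y = b := fun y =>
    ⟨fun hy => h.eq_of_adj_leaf hc hy hbc.symm, fun hy => hy ▸ hbc.symm⟩
  have hbadj : ∀ y, G.Adj b y ↔ y = e ∨ y = c := fun y =>
    ⟨fun hy => (hbC y hy).imp_right fun hyC => h₁ b y c (.inr hb) hy hbc hyC hc, fun hy =>
      hy.elim (fun hy => hy ▸ hbe) fun hy => hy ▸ hbc⟩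
  have hS : ∀ {x y}, S x ≠ S y → x ≠ y := fun h₁ h₂ => h₁ (congrArg S h₂)
  have hde' : d ≠ e := hS (by simp [hd, he])
  have hdb : d ≠ b := hS (by simp [hd, hb])
  have hdc : d ≠ c := hS (by simp [hd, hc])
  have heb : e ≠ b := hS (by simp [he, hb])
  have hec : e ≠ c := hS (by simp [he, hc])
  have hbc' : b ≠ c := hS (by simp [hb, hc])
  have had : a ≠ d := hS (by simp [hA, hd])
  have hae : a ≠ e := hS (by simp [hA, he])
  have hab : a ≠ b := hS (by simp [hA, hb])
  have hac : a ≠ c := hS (by simp [hA, hc])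
  obtain ⟨l, hl, hal⟩ := h.center_leaf
  have hld : l ≠ d := hS (by simp [hl, hd])
  have hle : l ≠ e := hS (by simp [hl, he])
  have hlb : l ≠ b := hS (by simp [hl, hb])
  have hlc : l ≠ c := fun hlc => hab ((hcadj a).1 (hlc ▸ hal.symm))
  have hla : l ≠ a := hal.ne'
  have hrange : ∀ y, y ∈ (Set.range ![d, e, b, c])ᶜ ↔ y ≠ d ∧ y ≠ e ∧ y ≠ b ∧ y ≠ c := by
    intro y
    simp [eq_comm]
    tauto
  -- The leg `d, e, b, c` can be removed only if another leg remains; with a single leg the graph is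
  -- already `P₆`.
  by_cases h₂ : ∃ b₀, S b₀ = .B ∧ b₀ ≠ b
  · have haR := (hrange a).2 ⟨had, hae, hab, hac⟩
    obtain ⟨f, hf, hf'⟩ := exists_iso_attachPath (G := G) (k := 3) (v := a) ![d, e, b, c]
      (by
        intro i j
        fin_cases i <;> fin_cases j <;>
          simp [hde', hdb, hdc, heb, hec, hbc', hde'.symm, hdb.symm, hdc.symm, heb.symm,
            hec.symm, hbc'.symm])
      (by
        simp [Fin.forall_fin_succ, SimpleGraph.pathGraph_adj, hde, hed, hbadj, hcadj, hde', hdb,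
          hdc, heb, hec, hae.symm, hab.symm, hac.symm, hdb.symm,
          hdc.symm, heb.symm, hec.symm, hbc'.symm]) haR
      (by
        intro y hy
        have hy' := (hrange y).1 hy
        simp [Fin.forall_fin_succ, G.adj_comm y, hde, hed, hbadj, hcadj, hy'])
    have hleg := h.induce haR ?_ ?_ ?_ ?_
    · refine ((ih _ (hcard _) hleg rfl).opTwo ⟨a, haR⟩ hA).iso f ?_
      simp [Sum.forall, Fin.forall_fin_succ, hf, hf', hb, hc, hd, he]
    · obtain ⟨b₀, hb₀, hne⟩ := h₂
      exact ⟨b₀, (hrange b₀).2 ⟨hS (by simp [hb₀, hd]), hS (by simp [hb₀, he]), hne,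
        hS (by simp [hb₀, hc])⟩, hb₀⟩
    · exact ⟨l, (hrange l).2 ⟨hld, hle, hlb, hlc⟩, hl, hal⟩
    · intro b₁ hb₁R hb₁
      obtain ⟨c₁, hc₁, hbc₁⟩ := h.leaf_B b₁ hb₁
      refine ⟨c₁, (hrange c₁).2 ⟨hS (by simp [hc₁, hd]), hS (by simp [hc₁, he]),
        hS (by simp [hc₁, hb]), ?_⟩, hc₁, hbc₁⟩
      rintro rfl
      exact ((hrange b₁).1 hb₁R).2.2.1 ((hcadj b₁).1 hbc₁.symm)
    · intro x hx hxa y hxy hy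
      obtain ⟨hxd, hxe, hxb, hxc⟩ := (hrange x).1 hx
      refine (hrange y).2 ⟨?_, ?_, ?_, ?_⟩ <;> rintro rfl
      · exact ((hde x).1 hxy.symm).elim hxe hxa
      · exact ((hed x).1 hxy.symm).elim hxb hxd
      · exact ((hbadj x).1 hxy.symm).elim hxe hxc
      · exact hy hc
  · push Not at h₂
    have hdE : ∀ y, S y = .E → y = e := by
      intro y hy
      obtain ⟨b₁, d₁, hb₁, -, h₃⟩ := h.adj_E y hy
      obtain rfl := h₂ b₁ hb₁
      exact ((hbadj y).1 ((h₃ b₁).2 (.inl rfl)).symm).resolve_right (hS (by simp [hy, hc]))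
    have hdD : ∀ y, S y = .D → y = d := by
      intro y hy
      obtain ⟨e₁, he₁, h₃⟩ := h.adj_D y hy
      obtain rfl := hdE e₁ he₁
      exact ((hed y).1 ((h₃ e₁).2 (.inl rfl)).symm).resolve_left (hS (by simp [hy, hb]))
    have hladj : ∀ y, G.Adj l y ↔ y = a := fun y =>
      ⟨fun hy => h.eq_of_adj_leaf hl hy hal.symm, fun hy => hy ▸ hal.symm⟩
    have haadj : ∀ y, G.Adj a y ↔ y = l ∨ y = d := fun y =>
      ⟨fun hy => (h.center_adj y hy).imp (fun hyC => h₁ a y l (.inl hA) hy hal hyC hl) (hdD y),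
        fun hy => hy.elim (fun hy => hy ▸ hal) fun hy => hy ▸ ((hde a).2 (.inr rfl)).symm⟩
    have hbij : Function.Bijective ![l, a, d, e, b, c] := by
      constructor
      · intro i j
        fin_cases i <;> fin_cases j <;>
          simp [hde', hdb, hdc, heb, hec, hbc', hde'.symm, hdb.symm, hdc.symm, heb.symm,
            hec.symm, hbc'.symm, had, hae, hab, hac, had.symm, hae.symm, hab.symm, hac.symm,
            hld, hle, hlb, hlc, hla, hld.symm, hle.symm, hlb.symm, hlc.symm, hla.symm]
      · intro y
        cases hy : S y
        · exact ⟨1, ((h.eq_center y).1 hy).symm⟩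
        · exact ⟨4, (h₂ y hy).symm⟩
        · obtain ⟨w, hw, hyw⟩ := h.adj_C y hy
          have hyw := ((hyw w).2 rfl).symm
          rcases hw with hw | hw
          · obtain rfl := (h.eq_center w).1 hw
            exact ⟨0, h₁ w l y (.inl hw) hal hyw hl hy⟩
          · obtain rfl := h₂ w hw
            exact ⟨5, h₁ w c y (.inr hw) hbc hyw hc hy⟩
        · exact ⟨2, (hdD y hy).symm⟩
        · exact ⟨3, (hdE y hy).symm⟩
    refine Family.base ⟨Equiv.ofBijective _ hbij, ?_⟩ ?_
    · intro i j
      fin_cases i <;> fin_cases j <;>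
        simp [SimpleGraph.pathGraph_adj, hladj, haadj, hde, hed, hbadj, hcadj, hde', hdb, hdc,
          heb, hec, hde'.symm, hdb.symm, hdc.symm, heb.symm,
          hec.symm, hbc'.symm, had, hae, hab, hac, had.symm, hae.symm, hab.symm, hac.symm,
          hld, hle, hlb, hlc, hla, hld.symm, hle.symm, hlb.symm, hlc.symm]
    · intro i
      fin_cases i
      exacts [hl, hA, hd, he, hb, hc]

/-! ### The lower bound for labeled trees -/

/-- The closed neighbourhood of the center and the legs are the fibres of a map that is constant
along all edges except those between the center and the legs. -/
theorem IsLegged.exists_root {S : V → Status} {a : V} (h : IsLegged G S a) :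
    ∃ ρ : V → V, (∀ x, S (ρ x) = .A ∨ S (ρ x) = .B) ∧
      (∀ x, S x = .A ∨ S x = .B → ρ x = x) ∧
      ∀ x y, G.Adj x y → S x ≠ .A → S x ≠ .D → ρ x = ρ y := by
  -- A leaf is sent to its support, and vertices of status `D` and `E` to the `B`-vertex of their
  -- leg. Only edges between the centre and the `D`-vertices then change fibre.
  have key : ∀ x, ∃ r, (S r = .A ∨ S r = .B) ∧ (S x = .A ∨ S x = .B → r = x) ∧
      (S x = .C → G.Adj x r) ∧ (S x = .E → G.Adj x r) ∧
      (S x = .D → ∃ e, S e = .E ∧ G.Adj x e ∧ G.Adj e r) := by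
    intro x
    cases hx : S x
    · exact ⟨x, by simp [hx]⟩
    · exact ⟨x, by simp [hx]⟩
    · obtain ⟨w, hw, hxw⟩ := h.adj_C x hx
      exact ⟨w, hw, by simp [hxw]⟩
    · obtain ⟨e, he, hxe⟩ := h.adj_D x hx
      obtain ⟨b, d, hb, hd, heb⟩ := h.adj_E e he
      exact ⟨b, .inr hb, by simp, by simp, by simp, fun _ =>
        ⟨e, he, (hxe e).2 (.inl rfl), (heb b).2 (.inl rfl)⟩⟩
    · obtain ⟨b, d, hb, hd, hxb⟩ := h.adj_E x hx
      exact ⟨b, .inr hb, by simp [hxb]⟩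
  choose ρ h₁ h₂ hC hE hD using key
  have leaf : ∀ c w, S c = .C → G.Adj c w → ρ c = ρ w := by
    intro c w hc hcw
    obtain ⟨w', hw', hcw'⟩ := h.adj_C c hc
    obtain rfl := (hcw' w).1 hcw
    rw [h₂ w hw']
    exact (hcw' _).1 (hC c hc)
  have leg : ∀ e y, S e = .E → G.Adj e y → ρ e = ρ y := by
    intro e y he hey
    obtain ⟨b, d, hb, hd, heb⟩ := h.adj_E e he
    have hr : ∀ r, (S r = .A ∨ S r = .B) → G.Adj e r → r = b := fun r hr her =>
      ((heb r).1 her).resolve_right fun h => by simp [h, hd] at hr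
    rw [hr _ (h₁ e) (hE e he)]
    rcases (heb y).1 hey with rfl | rfl
    · exact (h₂ y (.inr hb)).symm
    · obtain ⟨e', he', hye', her⟩ := hD y hd
      obtain ⟨e'', -, hy⟩ := h.adj_D y hd
      have hne : ∀ z, S z = .E → z ≠ a := fun z hz hza => by
        simp [(h.eq_center z).2 hza] at hz
      have h₃ := ((hy e).1 hey.symm).resolve_right (hne e he)
      have h₄ := ((hy e').1 hye').resolve_right (hne e' he')
      exact (hr _ (h₁ y) (h₃.trans h₄.symm ▸ her)).symm
  refine ⟨ρ, h₁, h₂, fun x y hxy hxA hxD => ?_⟩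
  cases hx : S x
  · exact absurd hx hxA
  · obtain ⟨e, he, -, hC⟩ := h.adj_B x hx
    rcases hC y hxy with rfl | hy
    · exact (leg y x he hxy.symm).symm
    · exact (leaf y x hy hxy.symm).symm
  · exact leaf x y hx hxy
  · exact absurd hx hxD
  · exact leg x y hx hxy

/-- Take the vertices of status `A` or `B` and count `X` along the fibres of `ρ`. Dominating a leaf
puts a vertex of `X` in every fibre; in a leg its partner lies in the same fibre. So `X` has at
least `1 + 2 * (D.card - 1)` elements. -/
theorem IsLegged.exists_isDominating [Fintype V] {S : V → Status} {a : V} (h : IsLegged G S a) :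
    ∃ D : Finset V, IsDominating G D ∧ 2 ≤ D.card ∧
      ∀ X, IsSemitotalDominating G X → 2 * D.card ≤ X.card + 1 := by
  classical
  obtain ⟨ρ, hρ, hρ', hadj⟩ := h.exists_root
  have hA := (h.eq_center a).2 rfl
  have haD : a ∈ Finset.univ.filter fun v => S v = .A ∨ S v = .B := by simp [hA]
  refine ⟨Finset.univ.filter fun v => S v = .A ∨ S v = .B, ?_, ?_, fun X hX => ?_⟩
  · intro v hv
    simp only [Finset.mem_filter, Finset.mem_univ, true_and] at hv ⊢
    cases hvS : S v
    · simp [hvS] at hv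
    · simp [hvS] at hv
    · obtain ⟨w, hw, hvw⟩ := h.adj_C v hvS
      exact ⟨w, hw, (hvw w).2 rfl⟩
    · obtain ⟨e, he, hve⟩ := h.adj_D v hvS
      exact ⟨a, .inl hA, (hve a).2 (.inr rfl)⟩
    · obtain ⟨b, d, hb, hd, hvb⟩ := h.adj_E v hvS
      exact ⟨b, .inr hb, (hvb b).2 (.inl rfl)⟩
  · obtain ⟨b, hb⟩ := h.exists_B
    refine Finset.one_lt_card.2 ⟨a, haD, b, by simp [hb], ?_⟩
    rintro rfl
    simp [hb] at hA
  · have hleaf : ∀ r c, S c = .C → G.Adj r c → ∃ v ∈ X, v = r ∨ v = c := by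
      intro r c hc hrc
      by_cases hcX : c ∈ X
      · exact ⟨c, hcX, .inr rfl⟩
      · obtain ⟨w, hw, hcw⟩ := hX.1 c hcX
        exact ⟨w, hw, .inl (h.eq_of_adj_leaf hc hcw hrc.symm)⟩
    rw [Finset.card_eq_sum_card_fiberwise (f := ρ) (s := X)
      (t := Finset.univ.filter fun v => S v = .A ∨ S v = .B) (by intro x _; simpa using hρ x),
      ← Finset.add_sum_erase _ _ haD]
    have ha : 1 ≤ (X.filter fun x => ρ x = a).card := by
      obtain ⟨c, hc, hac⟩ := h.center_leaf
      obtain ⟨v, hv, hvac⟩ := hleaf a c hc hac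
      refine Finset.card_pos.2 ⟨v, Finset.mem_filter.2 ⟨hv, ?_⟩⟩
      rcases hvac with rfl | rfl
      · exact hρ' v (.inl hA)
      · rw [hadj v a hac.symm (by simp [hc]) (by simp [hc]), hρ' a (.inl hA)]
    have hb := Finset.card_nsmul_le_sum
      ((Finset.univ.filter fun v => S v = .A ∨ S v = .B).erase a)
      (fun r => (X.filter fun x => ρ x = r).card) 2 (by
        intro b hb
        simp only [Finset.mem_erase, Finset.mem_filter, Finset.mem_univ, true_and,
          h.eq_center] at hb
        replace hb := hb.2.resolve_left hb.1
        obtain ⟨c, hc, hbc⟩ := h.leaf_B b hb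
        obtain ⟨e, he, -, hbC⟩ := h.adj_B b hb
        obtain ⟨v, hv, hvbc⟩ := hleaf b c hc hbc
        obtain ⟨w, hw, hwv, hvw⟩ := hX.2 v hv
        have hvb : ρ v = b := by
          rcases hvbc with rfl | rfl
          · exact hρ' v (.inr hb)
          · rw [hadj v b hbc.symm (by simp [hc]) (by simp [hc]), hρ' b (.inr hb)]
        have hvS : S v ≠ .A ∧ S v ≠ .D := by
          rcases hvbc with rfl | rfl
          · simp [hb]
          · simp [hc]
        -- Starting from `b` or its leaf, neither of the at most two steps to the partner starts at
        -- a vertex of status `A` or `D`, so the walk stays in the leg.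
        have hwb : ρ w = ρ v := by
          rcases adj_or_exists_adj_of_edist_le_two hvw hwv with hvw | ⟨u, hvu, huw⟩
          · exact (hadj v w hvw hvS.1 hvS.2).symm
          · have hu : S u ≠ .A ∧ S u ≠ .D := by
              rcases hvbc with rfl | rfl
              · rcases hbC u hvu with rfl | hu
                · simp [he]
                · simp [hu]
              · rw [h.eq_of_adj_leaf hc hvu hbc.symm]
                simp [hb]
            rw [hadj v u hvu hvS.1 hvS.2, hadj u w huw hu.1 hu.2]
        exact Finset.one_lt_card.2 ⟨v, by simp [hv, hvb], w, by simp [hw, hwb, hvb], hwv.symm⟩)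
    have hc := Finset.card_erase_add_one haD
    simp only [smul_eq_mul] at hb
    omega

theorem IsLegged.semitotalDominationNumber_add_one [Fintype V] {S : V → Status} {a : V}
    (h : IsLegged G S a) (hG : G.Connected) (hG' : ∀ v, ∃ w, G.Adj v w) :
    semitotalDominationNumber G + 1 = 2 * dominationNumber G := by
  obtain ⟨D, hD, hDc, hX⟩ := h.exists_isDominating
  obtain ⟨X, hXs, hXc⟩ := exists_card_eq_semitotalDominationNumber hG'
  obtain ⟨D₀, hD₀, hD₀c⟩ := exists_card_eq_dominationNumber G
  have h₁ := dominationNumber_le hD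
  have h₂ := hX X hXs
  -- Since `D` has at least two elements, `h₂` gives at least three vertices in `X`; with `h₃` this
  -- excludes domination number at most one, so `h₄` applies.
  have h₃ := semitotalDominationNumber_le_two_mul hG' hD₀
  have h₄ := semitotalDominationNumber_lt_two_mul hG hG' hD₀
  omega

/-! ### Structure of extremal dominating sets -/

/-- A symmetric relation without two disjoint pairs and without triangles is a star. -/
theorem exists_forall_eq_or_eq {α : Type*} {H : α → α → Prop} (hsymm : ∀ p q, H p q → H q p)
    (hdisj : ∀ p q p' q', H p q → H p' q' → p = p' ∨ p = q' ∨ q = p' ∨ q = q')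
    (htri : ∀ p q r, H p q → H q r → H p r → False) {p q : α} (hpq : H p q) :
    ∃ a, (a = p ∨ a = q) ∧ ∀ x y, H x y → x = a ∨ y = a := by
  by_contra! hne
  have other : ∀ a b, (a = p ∨ a = q) → H b a → ∃ r, r ≠ a ∧ H b r := by
    intro a b ha hba
    obtain ⟨x, y, hxy, hx, hy⟩ := hne a ha
    rcases hdisj b a x y hba hxy with rfl | rfl | h | h
    · exact ⟨y, hy, hxy⟩
    · exact ⟨x, hx, hsymm _ _ hxy⟩
    · exact absurd h.symm hx
    · exact absurd h.symm hy
  obtain ⟨r, hrp, hqr⟩ := other p q (.inl rfl) (hsymm _ _ hpq)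
  obtain ⟨s, hsq, hps⟩ := other q p (.inr rfl) hpq
  -- The pairs `q r` and `p s` must meet: `r = s` closes a triangle, and `q = p` gives a loop, which
  -- counts as a degenerate triangle.
  rcases hdisj q r p s hqr hps with rfl | h | h | rfl
  · exact htri q q q hpq hpq hpq
  · exact hsq h.symm
  · exact hrp h
  · exact htri p q r hpq hqr hps

theorem exists_labeling {D : Finset V} {a : V} (ha : a ∈ D) {P Q : V → Prop}
    (hP : ∀ v ∈ D, ¬ P v) (hQ : ∀ v ∈ D, ¬ Q v) (hPQ : ∀ v, P v → ¬ Q v) :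
    ∃ S : V → Status, (∀ v, S v = .A ↔ v = a) ∧ (∀ v, S v = .B ↔ v ∈ D ∧ v ≠ a) ∧
      (∀ v, S v = .D ↔ P v) ∧ (∀ v, S v = .E ↔ Q v) ∧
      ∀ v, S v = .C ↔ v ∉ D ∧ ¬ P v ∧ ¬ Q v := by
  classical
  refine ⟨fun v => if v = a then .A else if v ∈ D then .B else if P v then .D else
    if Q v then .E else .C, ?_, ?_, ?_, ?_, ?_⟩ <;> intro v <;> dsimp only <;>
    split_ifs <;> simp_all

/-- The dominating sets `D` for which the bound `γ_t2 ≤ 2 |D| - 1` is attained. -/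
structure IsExtremal (G : SimpleGraph V) (D : Finset V) (f : V → V) : Prop where
  isTree : G.IsTree
  exists_adj : ∀ v, ∃ w, G.Adj v w
  isDominating : IsDominating G D
  isDominator : IsDominator G D f
  two_le_card : 2 ≤ D.card
  two_mul_card_le : 2 * D.card ≤ semitotalDominationNumber G + 1

namespace IsExtremal

variable {D : Finset V} {f : V → V}

theorem lt_edist (h : IsExtremal G D f) {p q : V} (hp : p ∈ D) (hq : q ∈ D) (hpq : p ≠ q) :
    ¬ G.edist p q ≤ 2 := fun hle => by
  have := semitotalDominationNumber_add_two_le_of_near h.exists_adj h.isDominating hp hq hpq hle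
  have := h.two_mul_card_le
  omega

theorem notMem_of_adj (h : IsExtremal G D f) {x y : V} (hxy : G.Adj x y) (hne : f x ≠ f y) :
    x ∉ D := by
  intro hx
  have hle := h.isDominator.edist_le_two hxy.symm
  rw [h.isDominator.eq_self x hx] at hne
  exact h.lt_edist (h.isDominator.mem y) hx hne.symm hle

/-- The exchange principle behind the structure: `X` saves `K.card - X.card` vertices, and
extremality allows a saving of at most one. -/
theorem card_le_card_add_one (h : IsExtremal G D f) {X K : Finset V}
    (hX : ∀ x ∈ X, x ∉ D) (hKD : K ⊆ D)
    (hK : ∀ d ∈ K, ∃ x ∈ X, G.edist d x ≤ 2) : K.card ≤ X.card + 1 := by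
  have := semitotalDominationNumber_add_card_le h.exists_adj h.isDominating (X := X)
    (fun x hx => ⟨f x, h.isDominator.mem x, h.isDominator.adj x (hX x hx)⟩) hKD
    (fun d hd => by
      obtain ⟨x, hx, hdx⟩ := hK d hd
      exact ⟨x, .inr hx, fun hxd => hX x hx (hxd ▸ hKD hd), hdx⟩)
  have := h.two_mul_card_le
  omega

/-- Otherwise `x` and `x'` together would serve four members of `D`, a saving of two. -/
theorem not_disjoint (h : IsExtremal G D f) {x y x' y' : V} (hxy : G.Adj x y)
    (hne : f x ≠ f y) (hxy' : G.Adj x' y') (hne' : f x' ≠ f y') :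
    f x = f x' ∨ f x = f y' ∨ f y = f x' ∨ f y = f y' := by
  classical
  by_contra! hd
  have hx := h.notMem_of_adj hxy hne
  have hx' := h.notMem_of_adj hxy' hne'
  have hf := h.isDominator
  have := h.card_le_card_add_one (X := {x, x'}) (K := {f x, f y, f x', f y'})
    (by simp [hx, hx']) (by simp [Finset.insert_subset_iff, hf.mem]) (by
      simp only [Finset.mem_insert, Finset.mem_singleton]
      rintro d (rfl | rfl | rfl | rfl)
      · exact ⟨x, .inl rfl, edist_le_two_of_adj (hf.adj x hx).symm⟩
      · exact ⟨x, .inl rfl, hf.edist_le_two hxy.symm⟩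
      · exact ⟨x', .inr rfl, edist_le_two_of_adj (hf.adj x' hx').symm⟩
      · exact ⟨x', .inr rfl, hf.edist_le_two hxy'.symm⟩)
  have h₁ : ({x, x'} : Finset V).card ≤ 2 := Finset.card_le_two
  have h₂ : ({f x, f y, f x', f y'} : Finset V).card = 4 := by
    rw [Finset.card_insert_of_notMem (by simp [hne, hd]),
      Finset.card_insert_of_notMem (by simp [hd]), Finset.card_pair hne']
  omega

/-- Otherwise the single vertex `x` would serve three members of `D`. -/
theorem eq_of_adj_of_adj (h : IsExtremal G D f) {x y z : V} (hxy : G.Adj x y)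
    (hxz : G.Adj x z) (hy : f x ≠ f y) (hz : f x ≠ f z) : f y = f z := by
  classical
  by_contra hyz
  have hx := h.notMem_of_adj hxy hy
  have hf := h.isDominator
  have := h.card_le_card_add_one (X := {x}) (K := {f x, f y, f z})
    (by simpa using hx) (by simp [Finset.insert_subset_iff, hf.mem]) (by
      simp only [Finset.mem_insert, Finset.mem_singleton]
      rintro d (rfl | rfl | rfl)
      · exact ⟨x, rfl, edist_le_two_of_adj (hf.adj x hx).symm⟩
      · exact ⟨x, rfl, hf.edist_le_two hxy.symm⟩
      · exact ⟨x, rfl, hf.edist_le_two hxz.symm⟩)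
  rw [Finset.card_eq_three.2 ⟨_, _, _, hy, hz, hyz, rfl⟩] at this
  simp at this

/-- Each fibre induces a star: an edge between two vertices outside `D` would form a triangle with
their common dominator. -/
theorem eq_or_eq_of_adj (h : IsExtremal G D f) {x y : V} (hxy : G.Adj x y) (heq : f x = f y) :
    x = f y ∨ y = f x := by
  have hf := h.isDominator
  by_cases hx : x ∈ D
  · exact .inl ((hf.eq_self x hx).symm.trans heq)
  by_cases hy : y ∈ D
  · exact .inr ((hf.eq_self y hy).symm.trans heq.symm)
  obtain ⟨W, hxW, hyW, hW⟩ := exists_cut_of_isAcyclic h.isTree.2 hxy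
  have hxf := hf.adj x hx
  have hyf := hf.adj y hy
  rw [← heq] at hyf
  by_cases hfW : f x ∈ W
  · have hfx := hf.mem x
    rw [(hW _ _ hyf.symm hfW hyW).1] at hfx
    exact absurd hfx hx
  · exact .inr (hW _ _ hxf hxW hfW).2.symm

theorem exists_center (h : IsExtremal G D f) :
    ∃ a ∈ D, ∀ x y, G.Adj x y → f x ≠ f y → f x = a ∨ f y = a := by
  have hf := h.isDominator
  obtain ⟨p, hp, q, hq, hpq⟩ := Finset.one_lt_card.1 h.two_le_card
  obtain ⟨x₀, y₀, hxy₀, hx₀, hy₀⟩ := exists_adj_mem_notMem h.isTree.1 {v | f v = p}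
    (hf.eq_self p hp) (b := q) (by simpa [hf.eq_self q hq] using hpq.symm)
  simp only [Set.mem_ofPred_eq] at hx₀ hy₀
  obtain ⟨a, ha, hstar⟩ := exists_forall_eq_or_eq
    (H := fun p q => ∃ x y, G.Adj x y ∧ f x = p ∧ f y = q ∧ p ≠ q)
    (fun p q ⟨x, y, hxy, hx, hy, hne⟩ => ⟨y, x, hxy.symm, hy, hx, hne.symm⟩)
    (by
      rintro _ _ _ _ ⟨x, y, hxy, rfl, rfl, hne⟩ ⟨x', y', hxy', rfl, rfl, hne'⟩
      exact h.not_disjoint hxy hne hxy' hne')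
    (by
      rintro p q r ⟨x, y, hxy, rfl, rfl, hne⟩ ⟨y', z, hyz, hy', rfl, hne'⟩
        ⟨x', z', hxz, hx', hz', hne''⟩
      -- The third fibre lies on one side of the cut at `x y`, so one of the other two edges would
      -- also have to cross it.
      obtain ⟨Q, hx, hy, hQ⟩ := hf.exists_cut h.isTree.2 hxy hne
      by_cases hz : f z ∈ Q
      · obtain ⟨rfl, -⟩ := hQ z y' hyz.symm hz (hy' ▸ hy)
        exact hne'' rfl
      · obtain ⟨-, rfl⟩ := hQ x' z' hxz (hx' ▸ hx) (hz' ▸ hz)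
        exact hne' hz')
    ⟨x₀, y₀, hxy₀, rfl, rfl, fun h => hy₀ (h ▸ hx₀)⟩
  refine ⟨a, ?_, fun x y hxy hne => hstar _ _ ⟨x, y, hxy, rfl, rfl, hne⟩⟩
  rcases ha with rfl | rfl <;> exact hf.mem _

/-- Status `A` goes to the central member of `D`, `B` to the other members, `D` and `E` to the ends
of the unique edge between the central fibre and another one, and `C` to the rest. -/
theorem exists_isLegged (h : IsExtremal G D f) : ∃ S a, IsLegged G S a := by
  classical
  obtain ⟨a, haD, hstar⟩ := h.exists_center
  have hf := h.isDominator
  have hfa := hf.eq_self a haD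
  have hleg : ∀ b, ∃ x y, b ∈ D → b ≠ a → G.Adj x y ∧ f x = a ∧ f y = b := by
    intro b
    by_cases hb : b ∈ D ∧ b ≠ a
    · obtain ⟨y, x, hxy, hy, hx⟩ := exists_adj_mem_notMem h.isTree.1 {v | f v = b}
        (hf.eq_self b hb.1) (b := a) (by simpa [hfa] using hb.2.symm)
      simp only [Set.mem_ofPred_eq] at hx hy
      refine ⟨x, y, fun _ _ => ⟨hxy.symm, ?_, hy⟩⟩
      exact (hstar y x hxy (hy ▸ Ne.symm hx)).resolve_left (hy ▸ hb.2)
    -- Arbitrary values where no leg exists.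
    · exact ⟨a, a, fun h₁ h₂ => absurd ⟨h₁, h₂⟩ hb⟩
  choose d e hde using hleg
  have hadj : ∀ b ∈ D, b ≠ a → G.Adj (d b) (e b) := fun b h₁ h₂ => (hde b h₁ h₂).1
  have hfd : ∀ b ∈ D, b ≠ a → f (d b) = a := fun b h₁ h₂ => (hde b h₁ h₂).2.1
  have hfe : ∀ b ∈ D, b ≠ a → f (e b) = b := fun b h₁ h₂ => (hde b h₁ h₂).2.2
  have hne : ∀ b ∈ D, b ≠ a → f (d b) ≠ f (e b) := fun b h₁ h₂ => by
    rw [hfd b h₁ h₂, hfe b h₁ h₂]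
    exact h₂.symm
  have hdD : ∀ b ∈ D, b ≠ a → d b ∉ D := fun b h₁ h₂ =>
    h.notMem_of_adj (hadj b h₁ h₂) (hne b h₁ h₂)
  have heD : ∀ b ∈ D, b ≠ a → e b ∉ D := fun b h₁ h₂ =>
    h.notMem_of_adj (hadj b h₁ h₂).symm (hne b h₁ h₂).symm
  have had : ∀ b ∈ D, b ≠ a → G.Adj a (d b) := fun b h₁ h₂ => by
    simpa [hfd b h₁ h₂] using (hf.adj _ (hdD b h₁ h₂)).symm
  have hbe : ∀ b ∈ D, b ≠ a → G.Adj b (e b) := fun b h₁ h₂ => by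
    simpa [hfe b h₁ h₂] using (hf.adj _ (heD b h₁ h₂)).symm
  have huniq : ∀ x y, G.Adj x y → f x = a → f y ≠ a → x = d (f y) ∧ y = e (f y) := by
    intro x y hxy hx hy
    have hyD := hf.mem y
    obtain ⟨Q, h₁, h₂, hQ⟩ := hf.exists_cut h.isTree.2 (hadj _ hyD hy) (hne _ hyD hy)
    rw [hfd _ hyD hy] at h₁
    rw [hfe _ hyD hy] at h₂
    exact hQ x y hxy (hx ▸ h₁) h₂
  have hdinj : ∀ b ∈ D, b ≠ a → ∀ b' ∈ D, b' ≠ a → d b = d b' → b = b' := by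
    intro b h₁ h₂ b' h₁' h₂' hdd
    have := h.eq_of_adj_of_adj (hadj b h₁ h₂) (hdd ▸ hadj b' h₁' h₂') (hne b h₁ h₂)
      (hdd ▸ hne b' h₁' h₂')
    rwa [hfe b h₁ h₂, hfe b' h₁' h₂'] at this
  obtain ⟨S, hSA, hSB, hSD, hSE, hSC⟩ := exists_labeling haD
    (P := fun v => ∃ b ∈ D, b ≠ a ∧ v = d b) (Q := fun v => ∃ b ∈ D, b ≠ a ∧ v = e b)
    (by
      rintro _ hvD ⟨b, hb, hba, rfl⟩
      exact hdD b hb hba hvD)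
    (by
      rintro _ hvD ⟨b, hb, hba, rfl⟩
      exact heD b hb hba hvD)
    (by
      rintro _ ⟨b', hb', hba', h₅⟩ ⟨b, hb, hba, rfl⟩
      have := hfe b hb hba
      rw [h₅, hfd b' hb' hba'] at this
      exact hba this.symm)
  have hd_of : ∀ {x b}, b ∈ D → b ≠ a → x = d b → f x = a := fun hb hba hx => hx ▸ hfd _ hb hba
  have he_of : ∀ {x b}, b ∈ D → b ≠ a → x = e b → f x = b := fun hb hba hx => hx ▸ hfe _ hb hba
  have hfD : ∀ {x y}, x ∈ D → G.Adj x y → f y = x := by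
    intro x y hx hxy
    by_contra hne
    refine h.notMem_of_adj hxy ?_ hx
    rw [hf.eq_self x hx]
    exact Ne.symm hne
  have hnD : ∀ {x y}, x ∈ D → G.Adj x y → y ∉ D := by
    intro x y hx hxy hy
    exact hxy.ne ((hfD hx hxy).symm.trans (hf.eq_self y hy))
  have hin : ∀ {x y}, x ∉ D → G.Adj x y → f x = f y → y = f x := by
    intro x y hx hxy heq
    exact (h.eq_or_eq_of_adj hxy heq).resolve_left fun hx' => hx (hx' ▸ hf.mem y)
  refine ⟨S, a, hSA, ?_, ?_, ?_, ?_, ?_, ?_, ?_, ?_⟩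
  · obtain ⟨b, hb, hba⟩ := Finset.exists_mem_ne h.two_le_card a
    exact ⟨b, (hSB b).2 ⟨hb, hba⟩⟩
  · by_contra! hC
    -- Without a leaf at `a`, the centre can be dropped: each `b` is paired with `d b` at distance
    -- two, and the vertices `d b` dominate `a`. This uses only `2 * (D.card - 1)` vertices.
    have hX : IsSemitotalDominating G (D.erase a ∪ (D.erase a).image d) := by
      refine ⟨fun v hv => ?_, fun v hv => ?_⟩
      · by_cases hva : v = a
        · obtain ⟨b, hb, hba⟩ := Finset.exists_mem_ne h.two_le_card a
          refine ⟨d b, ?_, hva ▸ had b hb hba⟩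
          exact Finset.mem_union_right _
            (Finset.mem_image_of_mem d (Finset.mem_erase.2 ⟨hba, hb⟩))
        · have hvD : v ∉ D := fun hvD =>
            hv (Finset.mem_union_left _ (Finset.mem_erase.2 ⟨hva, hvD⟩))
          refine ⟨f v, Finset.mem_union_left _ (Finset.mem_erase.2 ⟨?_, hf.mem v⟩), hf.adj v hvD⟩
          intro hfv
          refine hC v ((hSC v).2 ⟨hvD, ?_, ?_⟩) (hfv ▸ (hf.adj v hvD).symm)
          · rintro ⟨b, hb, hba, rfl⟩
            exact hv (Finset.mem_union_right _
              (Finset.mem_image_of_mem d (Finset.mem_erase.2 ⟨hba, hb⟩)))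
          · rintro ⟨b, hb, hba, hvb⟩
            exact hba ((he_of hb hba hvb).symm.trans hfv)
      · rcases Finset.mem_union.1 hv with hv | hv
        · obtain ⟨hva, hvD⟩ := Finset.mem_erase.1 hv
          exact ⟨d v, Finset.mem_union_right _ (Finset.mem_image_of_mem d hv),
            fun hdv => hdD v hvD hva (hdv.symm ▸ hvD),
            edist_le_two_of_adj_of_adj (hbe v hvD hva) (hadj v hvD hva).symm⟩
        · obtain ⟨b, hb, rfl⟩ := Finset.mem_image.1 hv
          obtain ⟨hba, hbD⟩ := Finset.mem_erase.1 hb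
          exact ⟨b, Finset.mem_union_left _ hb, fun hdb => hdD b hbD hba (hdb ▸ hbD),
            edist_le_two_of_adj_of_adj (hadj b hbD hba) (hbe b hbD hba).symm⟩
    have h₁ := semitotalDominationNumber_le hX
    have h₂ := Finset.card_union_le (D.erase a) ((D.erase a).image d)
    have h₃ := Finset.card_image_le (s := D.erase a) (f := d)
    have h₄ := Finset.card_erase_add_one haD
    have h₅ := h.two_mul_card_le
    omega
  · intro y hay
    rw [hSC, hSD]
    by_cases hy : ∃ b ∈ D, b ≠ a ∧ y = d b
    · exact .inr hy
    · refine .inl ⟨hnD haD hay, hy, ?_⟩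
      rintro ⟨b, hb, hba, hyb⟩
      exact hba ((he_of hb hba hyb).symm.trans (hfD haD hay))
  · intro b hb
    obtain ⟨hb, hba⟩ := (hSB b).1 hb
    by_contra! hC
    -- Without a leaf at `b`, it can be exchanged for `e b` at no cost; but `e b` is within distance
    -- two of `a`, which saves two.
    have hD' : IsDominating G (insert (e b) (D.erase b)) := by
      intro v hv
      simp only [Finset.mem_insert, Finset.mem_erase, not_or, not_and] at hv
      by_cases hvb : v = b
      · exact ⟨e b, Finset.mem_insert_self _ _, hvb ▸ hbe b hb hba⟩
      · have hvD : v ∉ D := hv.2 hvb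
        refine ⟨f v, Finset.mem_insert_of_mem (Finset.mem_erase.2 ⟨?_, hf.mem v⟩), hf.adj v hvD⟩
        intro hfv
        refine hC v ((hSC v).2 ⟨hvD, ?_, ?_⟩) (hfv ▸ (hf.adj v hvD).symm)
        · rintro ⟨b', hb', hba', hvb'⟩
          exact hba (hfv.symm.trans (hd_of hb' hba' hvb'))
        · rintro ⟨b', hb', hba', hvb'⟩
          obtain rfl : b' = b := (he_of hb' hba' hvb').symm.trans hfv
          exact hv.1 hvb'
    have h₁ := semitotalDominationNumber_add_two_le_of_near h.exists_adj hD'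
      (p := a) (q := e b) (Finset.mem_insert_of_mem (Finset.mem_erase.2 ⟨hba.symm, haD⟩))
      (Finset.mem_insert_self _ _) (fun hae => heD b hb hba (hae ▸ haD))
      (edist_le_two_of_adj_of_adj (had b hb hba) (hadj b hb hba))
    have h₂ := Finset.card_insert_le (e b) (D.erase b)
    have h₃ := Finset.card_erase_add_one hb
    have h₄ := h.two_mul_card_le
    omega
  · intro b hb
    obtain ⟨hb, hba⟩ := (hSB b).1 hb
    refine ⟨e b, (hSE _).2 ⟨b, hb, hba, rfl⟩, hbe b hb hba, fun y hby => ?_⟩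
    rw [hSC, or_iff_not_imp_left]
    refine fun hy => ⟨hnD hb hby, ?_, ?_⟩
    · rintro ⟨b', hb', hba', hyb'⟩
      exact hba ((hfD hb hby).symm.trans (hd_of hb' hba' hyb'))
    · rintro ⟨b', hb', hba', hyb'⟩
      obtain rfl : b' = b := (he_of hb' hba' hyb').symm.trans (hfD hb hby)
      exact hy hyb'
  · intro c hc
    obtain ⟨hcD, hcd, hce⟩ := (hSC c).1 hc
    refine ⟨f c, ?_, fun y => ⟨fun hcy => ?_, fun hy => hy ▸ hf.adj c hcD⟩⟩
    · rw [hSA, hSB]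
      exact (em (f c = a)).imp_right fun hne => ⟨hf.mem c, hne⟩
    · by_cases heq : f c = f y
      · exact hin hcD hcy heq
      -- An edge leaving the fibre is the edge of some leg, so `c` would be a `d` or an `e`.
      · rcases hstar c y hcy heq with hfc | hfy
        · have hya : f y ≠ a := fun hfy => heq (hfc.trans hfy.symm)
          exact absurd ⟨f y, hf.mem y, hya, (huniq c y hcy hfc hya).1⟩ hcd
        · have hca : f c ≠ a := fun hfc => heq (hfc.trans hfy.symm)
          exact absurd ⟨f c, hf.mem c, hca, (huniq y c hcy.symm hfy hca).2⟩ hce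
  · intro x hx
    obtain ⟨b, hb, hba, rfl⟩ := (hSD x).1 hx
    refine ⟨e b, (hSE _).2 ⟨b, hb, hba, rfl⟩, fun y => ⟨fun hy => ?_, ?_⟩⟩
    · by_cases hfy : f y = a
      · refine .inr ((hin (hdD b hb hba) hy ?_).trans (hfd b hb hba))
        rw [hfy, hfd b hb hba]
      · obtain ⟨h₁, h₂⟩ := huniq _ _ hy (hfd b hb hba) hfy
        rw [hdinj b hb hba _ (hf.mem y) hfy h₁]
        exact .inl h₂
    · rintro (rfl | rfl)
      · exact hadj b hb hba
      · exact (had b hb hba).symm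
  · intro x hx
    obtain ⟨b, hb, hba, rfl⟩ := (hSE x).1 hx
    refine ⟨b, d b, (hSB b).2 ⟨hb, hba⟩, (hSD _).2 ⟨b, hb, hba, rfl⟩, fun y => ⟨fun hy => ?_, ?_⟩⟩
    · by_cases hfy : f y = b
      · refine .inl ((hin (heD b hb hba) hy ?_).trans (hfe b hb hba))
        rw [hfy, hfe b hb hba]
      · have hfe' := hfe b hb hba
        have hfa' := (hstar _ _ hy (by rw [hfe']; exact Ne.symm hfy)).resolve_left (by rwa [hfe'])
        have := (huniq _ _ hy.symm hfa' (by rwa [hfe'])).1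
        rw [hfe'] at this
        exact .inr this
    · rintro (rfl | rfl)
      · exact (hbe y hb hba).symm
      · exact (hadj b hb hba).symm

end IsExtremal

end SemitotalDomination

/-! ### The theorem -/

theorem theorem3p1 {V : Type*} [Fintype V] [Nontrivial V] (T : SimpleGraph V) (hT : T.IsTree) :
    (¬ SemitotalDomination.IsStar T →
      (SemitotalDomination.semitotalDominationNumber T : ℤ) ≤
        2 * (SemitotalDomination.dominationNumber T : ℤ) - 1) ∧
    ((SemitotalDomination.semitotalDominationNumber T : ℤ) =
        2 * (SemitotalDomination.dominationNumber T : ℤ) - 1 ↔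
      ∃ S : V → SemitotalDomination.Status, SemitotalDomination.Family T S) := by
  open SemitotalDomination in
  have hadj := hT.1.preconnected.exists_adj_of_nontrivial
  obtain ⟨D, hD, hc⟩ := exists_card_eq_dominationNumber T
  refine ⟨fun hstar => ?_, fun heq => ?_, fun ⟨S, hS⟩ => ?_⟩
  · have h₁ : ¬ D.card ≤ 1 := fun h => hstar (isStar_of_isDominating_card_le_one hT hD h)
    have h₂ := semitotalDominationNumber_lt_two_mul hT.1 hadj hD (by omega)
    omega
  -- With the equality, this forces domination number at least two, as `IsExtremal` requires.
  · have h₁ := two_le_semitotalDominationNumber hadj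
    obtain ⟨f, hf⟩ := hD.exists_isDominator
    have hext : IsExtremal T D f := ⟨hT, hadj, hD, hf, by omega, by omega⟩
    obtain ⟨S, a, hS⟩ := hext.exists_isLegged
    exact ⟨S, hS.family⟩
  · obtain ⟨a, ha⟩ := hS.exists_isLegged
    have := ha.semitotalDominationNumber_add_one hT.1 hadj
    omega
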